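/- A hierarchical clustering tree (HC-tree) on $V=\{1,\dots,n\}$ is a finite rooted tree $T$ whose leaf set is $V$; write $\mathrm{LCA}$ for lowest common ancestors in $T$. Let $w$ be a symmetric matrix of non-negative weights on $V$. For a triplet $\{i,j,k\}$ of distinct elements of $V$, say that $\{i,j\mid k\}$ holds in $T$ if $\mathrm{LCA}(i,j)$ is a proper descendant of $\mathrm{LCA}(i,j,k)$. The cost $c_T(i,j,k)$ of the triplet is $w_{ik}+w_{jk}$ if $\{i,j\mid k\}$ holds, $w_{ij}+w_{jk}$ if $\{i,k\mid j\}$ holds, $w_{ij}+w_{ik}$ if $\{j,k\mid i\}$ holds, and $w_{ij}+w_{jk}+w_{ik}$ if none of them holds. The total-cost of $T$ is $\sum_{\{i,j,k\}} c_T(i,j,k)$, and the base-cost is $\sum_{\{i,j,k\}} \min\{w_{ij}+w_{ik},\,w_{ij}+w_{jk},\,w_{ik}+w_{jk}\}$, both sums over all triplets. The ratio-cost of $T$ is its total-cost divided by the base-cost, with the conventions $0/0=1$ and $x/0=+\infty$ for $x>0$. For an unweighted graph $G$ on $V$ (with $w_{ij}=1$ if $ij$ is an edge and $w_{ij}=0$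 otherwise), the optimal ratio-cost $\rho^*_G$ is the minimum of the ratio-costs of all HC-trees on $V$. Corollary. Let $p=p(n)\in[0,1]$ satisfy $p=\omega\!\left(\sqrt{\tfrac{\log n}{n}}\right)$ as $n\to\infty$, and let $G$ be an Erdős–Rényi random graph $G(n,p)$, in which each of the $\binom n2$ possible edges is present independently with probability $p$. Then with high probability $$\rho^*_G=(1+o(1))\,\frac{2}{3p-p^2}.$$ That is, there is an absolute constant $\varepsilon>0$ such that, for every such $p$, there is a deterministic sequence $\delta_n\to 0$ for which, for all sufficiently large $n$, $$\mathbb P\left[\,\rho^*_G<\infty\ \text{ and }\ \left|\rho^*_G-\frac{2}{3p-p^2}\right|\le \delta_n\cdot\frac{2}{3p-p^2}\,\right]>1-n^{-\varepsilon}.$$ -/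

import Mathlib

open Filter Topology Asymptotics
open scoped NNReal ENNReal

/-- A hierarchical clustering tree on `V`: a finite rooted tree (not necessarily binary) whose
leaves are labelled bijectively by `V`. In a `RootedTree` the order is the ancestor order with the
root `⊥` as least element, so `x ⊓ y` is the lowest common ancestor of `x` and `y`, `x < y` says
that `y` is a proper descendant of `x`, and the leaves are the maximal elements. -/
structure HCTree (V : Type*) where
  /-- The underlying rooted tree. -/
  tree : RootedTree.{0}
  finite : Finite tree
  /-- The leaf that carries a given data point. -/
  leaf : V → tree
  leaf_injective : Function.Injective leaf
  range_leaf : Set.range leaf = {x | IsMax x}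

namespace HCTree

variable {V : Type*}

/-- The lowest common ancestor of the leaves of two data points. -/
def lca (T : HCTree V) (i j : V) : T.tree := T.leaf i ⊓ T.leaf j

/-- The lowest common ancestor of the leaves of three data points. -/
def lca₃ (T : HCTree V) (i j k : V) : T.tree := T.leaf i ⊓ T.leaf j ⊓ T.leaf k

/-- The relation `{i, j | k}`: the lowest common ancestor of `i` and `j` is a proper descendant of
that of `i`, `j`, `k`. -/
def MergesFirst (T : HCTree V) (i j k : V) : Prop := T.lca₃ i j k < T.lca i j

open Classical in
/-- The cost of the triplet `{i, j, k}` induced by `T`, for the similarity matrix `w`. The last case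
is the relation `{i | j | k}`, where all three are merged at the same node. -/
noncomputable def tripletCost (T : HCTree V) (w : V → V → ℝ≥0) (i j k : V) : ℝ≥0 :=
  if T.MergesFirst i j k then w i k + w j k
  else if T.MergesFirst i k j then w i j + w j k
  else if T.MergesFirst j k i then w i j + w i k
  else w i j + w j k + w i k

end HCTree

/-- The least cost that a tree can induce on the triplet `{i, j, k}`. -/
noncomputable def minTripletCost {V : Type*} (w : V → V → ℝ≥0) (i j k : V) : ℝ≥0 :=
  min (w i j + w i k) (min (w i j + w j k) (w i k + w j k))

/-- The total-cost of `T`: the sum of the costs of all (unordered) triplets. -/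
noncomputable def totalCost {n : ℕ} (w : Fin n → Fin n → ℝ≥0) (T : HCTree (Fin n)) : ℝ≥0 :=
  ∑ i, ∑ j, ∑ k, if i < j ∧ j < k then T.tripletCost w i j k else 0

/-- The base-cost: the sum of the min-triplet costs of all (unordered) triplets. -/
noncomputable def baseCost {n : ℕ} (w : Fin n → Fin n → ℝ≥0) : ℝ≥0 :=
  ∑ i, ∑ j, ∑ k, if i < j ∧ j < k then minTripletCost w i j k else 0

open Classical in
/-- The ratio-cost of `T`, with the conventions `0 / 0 = 1` and `x / 0 = ∞` for `x > 0` (the latter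
is that of division in `ℝ≥0∞`). -/
noncomputable def ratioCost {n : ℕ} (w : Fin n → Fin n → ℝ≥0) (T : HCTree (Fin n)) : ℝ≥0∞ :=
  if totalCost w T = 0 ∧ baseCost w = 0 then 1 else (totalCost w T : ℝ≥0∞) / (baseCost w : ℝ≥0∞)

/-- The optimal ratio-cost: the least ratio-cost of all hierarchical clustering trees. The
infimum is attained as soon as there is a tree, that is for `n ≥ 1`; see `exists_ratioCost_eq_optimalRatioCost`. -/
noncomputable def optimalRatioCost {n : ℕ} (w : Fin n → Fin n → ℝ≥0) : ℝ≥0∞ :=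
  ⨅ T : HCTree (Fin n), ratioCost w T

theorem exists_ratioCost_eq_optimalRatioCost {n : ℕ} [Nonempty (HCTree (Fin n))]
    (w : Fin n → Fin n → ℝ≥0) :
    ∃ T : HCTree (Fin n), ratioCost w T = optimalRatioCost w := by
  classical
  have key : ∀ T T' : HCTree (Fin n), T.MergesFirst = T'.MergesFirst →
      ratioCost w T = ratioCost w T' := by
    intro T T' h
    have ht : ∀ i j k, T.tripletCost w i j k = T'.tripletCost w i j k := by
      intro i j k
      unfold HCTree.tripletCost
      rw [h]
    have hc : totalCost w T = totalCost w T' := by simp only [totalCost, ht]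
    unfold ratioCost
    rw [hc]
  have hfin : (Set.range (ratioCost w)).Finite := by
    let F : (Fin n → Fin n → Fin n → Prop) → ℝ≥0∞ := fun R =>
      if h : ∃ T : HCTree (Fin n), T.MergesFirst = R then ratioCost w h.choose else 0
    refine (Set.finite_range F).subset ?_
    rintro _ ⟨T, rfl⟩
    have h : ∃ T' : HCTree (Fin n), T'.MergesFirst = T.MergesFirst := ⟨T, rfl⟩
    exact ⟨T.MergesFirst, by simp only [F, dif_pos h]; exact key _ _ h.choose_spec⟩
  exact (Set.range_nonempty (ratioCost w)).csInf_mem hfin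

open Classical in
/-- The similarity matrix of an unweighted graph: every edge has unit weight. -/
noncomputable def unitWeight {V : Type*} (G : SimpleGraph V) : V → V → ℝ≥0 :=
  fun i j => if G.Adj i j then 1 else 0

/-! ### Sums over triplets -/

section Sums

variable {α M : Type*} [Fintype α] [AddCommMonoid M]

/-! Write `u = √(n log n)`. The graph is compared with the constant matrix `p`, uniformly over all
trees.

Numerator: a tree pays the weight of a pair once for every third leaf below the pair's LCA, so the
total cost is the sum over pairs of `(lcaCard - 2)` times the weight. The function `lcaCard` is an
ultrametric, hence its level sets are partitions of the vertices, and the total cost is a sum of at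
most `n` weights of multiway cuts. There are at most `n ^ n` labellings, few enough for Hoeffding
and a union bound to control every cut within `n * u`. So each tree costs `p` times its cost on the
complete graph, up to `n ^ 2 * u`. On the complete graph every triplet costs at least 2, with
equality for a caterpillar, so the least total cost is about `p n³ / 3`.

Denominator: the base cost counts pairs of neighbours of a common vertex, with a correction for
triangles. Degrees near `pn` and edge density near `p` inside every neighbourhood make it about `(3
- p) p² n³ / 6`.

The quotient is `2 / (3p - p²)`. All relative errors are of order `(u + 1) / (pn)`, which tends to 0
exactly because `p` dominates `√(log n / n)`. The carrying lemmas are `two_mul_totalCost`,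
`binomialRandom_real_not_isQuasirandom_le`, `IsQuasirandom.abs_totalCost_sub_le` and
`IsQuasirandom.optimalRatioCost_approx`. -/

theorem sum_triple_swap_left (f : α → α → α → M) :
    ∑ i, ∑ j, ∑ k, f j i k = ∑ i, ∑ j, ∑ k, f i j k :=
  Finset.sum_comm

theorem sum_triple_swap_right (f : α → α → α → M) :
    ∑ i, ∑ j, ∑ k, f i k j = ∑ i, ∑ j, ∑ k, f i j k :=
  Finset.sum_congr rfl fun _ _ => Finset.sum_comm

/-- A sum over ordered triples of distinct elements as a sum over increasing triples. -/
theorem sum_distinct_triple [LinearOrder α] (g : α → α → α → M) :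
    ∑ i, ∑ j, ∑ k, (if i ≠ j ∧ j ≠ k ∧ i ≠ k then g i j k else 0) =
      ∑ i, ∑ j, ∑ k, (if i < j ∧ j < k then
        g i j k + g i k j + g j i k + g j k i + g k i j + g k j i else 0) := by
  let h (i j k : α) (x : M) : M := if i < j ∧ j < k then x else 0
  -- A triple of distinct elements is increasing in exactly one of its six orders; renaming the
  -- summation variables then brings each of the six sums to the increasing order.
  have e : ∀ i j k, (if i ≠ j ∧ j ≠ k ∧ i ≠ k then g i j k else 0) =
      h i j k (g i j k) + h i k j (g i j k) + h j i k (g i j k) + h j k i (g i j k)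
        + h k i j (g i j k) + h k j i (g i j k) := by
    intro i j k
    simp only [h]
    by_cases hd : i ≠ j ∧ j ≠ k ∧ i ≠ k
    · obtain ⟨hij, hjk, hik⟩ := hd
      rcases hij.lt_or_gt with h1 | h1 <;> rcases hjk.lt_or_gt with h2 | h2 <;>
        rcases hik.lt_or_gt with h3 | h3 <;>
        first
        | (exfalso; order)
        | simp [hij, hjk, hik, h1, h2, h3, h1.not_gt, h2.not_gt, h3.not_gt]
    · rw [if_neg hd]
      repeat rw [if_neg (fun hlt => hd ⟨by rintro rfl; order, by rintro rfl; order,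
        by rintro rfl; order⟩)]
      simp
  have e' : ∀ i j k, (if i < j ∧ j < k then
        g i j k + g i k j + g j i k + g j k i + g k i j + g k j i else 0) =
      h i j k (g i j k) + h i j k (g i k j) + h i j k (g j i k) + h i j k (g k i j)
        + h i j k (g j k i) + h i j k (g k j i) := by
    intro i j k
    simp only [h]
    split_ifs
    · abel
    · simp
  simp only [e, e', Finset.sum_add_distrib]
  congr 1; congr 1; congr 1; congr 1; congr 1
  · exact sum_triple_swap_right fun i j k => h i j k (g i k j)
  · exact sum_triple_swap_left fun i j k => h i j k (g j i k)
  · calc ∑ i, ∑ j, ∑ k, h j k i (g i j k)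
        = ∑ i, ∑ j, ∑ k, h i k j (g j i k) := sum_triple_swap_left fun i j k => h i k j (g j i k)
      _ = _ := sum_triple_swap_right fun i j k => h i j k (g k i j)
  · calc ∑ i, ∑ j, ∑ k, h k i j (g i j k)
        = ∑ i, ∑ j, ∑ k, h j i k (g i k j) := sum_triple_swap_right fun i j k => h j i k (g i k j)
      _ = _ := sum_triple_swap_left fun i j k => h i j k (g j k i)
  · calc ∑ i, ∑ j, ∑ k, h k j i (g i j k)
        = ∑ i, ∑ j, ∑ k, h k i j (g j i k) := sum_triple_swap_left fun i j k => h k i j (g j i k)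
      _ = ∑ i, ∑ j, ∑ k, h j i k (g k i j) := sum_triple_swap_right fun i j k => h j i k (g k i j)
      _ = _ := sum_triple_swap_left fun i j k => h i j k (g k j i)

end Sums

/-! ### The cost of a tree as a sum over pairs -/

namespace HCTree

variable {V : Type*} (T : HCTree V)

theorem lca_comm (i j : V) : T.lca i j = T.lca j i := inf_comm _ _

theorem mergesFirst_iff {i j k : V} : T.MergesFirst i j k ↔ ¬ T.lca i j ≤ T.leaf k := by
  unfold MergesFirst lca₃ lca
  rw [lt_iff_le_and_ne, and_iff_right inf_le_left, Ne, inf_eq_left]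

theorem lca_le_leaf_left (i j : V) : T.lca i j ≤ T.leaf i := inf_le_left

theorem lca_le_leaf_right (i j : V) : T.lca i j ≤ T.leaf j := inf_le_right

/-- Two common ancestors of a leaf are comparable. -/
theorem lca_le_leaf_or (i j k : V) : T.lca i j ≤ T.leaf k ∨ T.lca i k ≤ T.leaf j := by
  rcases le_total_of_directed (T.lca_le_leaf_left i j) (T.lca_le_leaf_left i k) with h | h
  · exact .inr (h.trans (T.lca_le_leaf_right i j))
  · exact .inl (h.trans (T.lca_le_leaf_right i k))

open Classical in
-- By `lca_le_leaf_or`, at most one of the three conditions fails, and it fails for the pair that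
-- merges first. This makes the cost additive over pairs.
theorem tripletCost_eq (w : V → V → ℝ≥0) (i j k : V) :
    T.tripletCost w i j k = (if T.lca i j ≤ T.leaf k then w i j else 0) +
      (if T.lca i k ≤ T.leaf j then w i k else 0) +
      (if T.lca j k ≤ T.leaf i then w j k else 0) := by
  have h1 := T.lca_le_leaf_or i j k
  have h2 := T.lca_le_leaf_or j i k
  have h3 := T.lca_le_leaf_or k i j
  rw [T.lca_comm j i] at h2
  rw [T.lca_comm k i, T.lca_comm k j] at h3
  unfold tripletCost
  simp only [mergesFirst_iff]
  by_cases a : T.lca i j ≤ T.leaf k <;> by_cases b : T.lca i k ≤ T.leaf j <;>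
    by_cases c : T.lca j k ≤ T.leaf i <;> simp_all [add_comm, add_left_comm]

section Card

variable [Fintype V]

open Classical in
/-- The number of leaves below the lowest common ancestor of two leaves. -/
noncomputable def lcaCard (i j : V) : ℕ := (Finset.univ.filter fun k => T.lca i j ≤ T.leaf k).card

theorem lcaCard_comm (i j : V) : T.lcaCard i j = T.lcaCard j i := by
  unfold lcaCard
  rw [T.lca_comm]

theorem lcaCard_le (i j : V) : T.lcaCard i j ≤ Fintype.card V := Finset.card_le_univ _

theorem lcaCard_le_of_le {i j k l : V} (h : T.lca i j ≤ T.lca k l) :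
    T.lcaCard k l ≤ T.lcaCard i j :=
  Finset.card_le_card fun _ hm => by
    simp only [Finset.mem_filter, Finset.mem_univ, true_and] at hm ⊢
    exact h.trans hm

/-- The ultrametric inequality: both LCAs are ancestors of `j`, hence comparable, and the higher one
is a common ancestor of `i` and `k`. -/
theorem lcaCard_le_max (i j k : V) : T.lcaCard i k ≤ max (T.lcaCard i j) (T.lcaCard j k) := by
  rcases le_total_of_directed (T.lca_le_leaf_right i j) (T.lca_le_leaf_left j k) with h | h
  rotate_left
  · exact (T.lcaCard_le_of_le (le_inf (T.lca_le_leaf_left i j)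
      (h.trans (T.lca_le_leaf_right j k)))).trans (le_max_left _ _)
  · exact (T.lcaCard_le_of_le (le_inf (h.trans (T.lca_le_leaf_left i j))
      (T.lca_le_leaf_right j k))).trans (le_max_right _ _)

/-- The clusters of size at most `s`: two leaves are labelled equally if and only if their lowest
common ancestor has at most `s` leaves below it. -/
theorem exists_label (s : ℕ) :
    ∃ f : V → V, ∀ i j, i ≠ j → (f i ≠ f j ↔ s < T.lcaCard i j) := by
  let r : Setoid V :=
    -- The clause `i = j` is needed for `s = 0`, since a leaf always lies below itself.
    { r := fun i j => i = j ∨ T.lcaCard i j ≤ s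
      iseqv := by
        refine ⟨fun i => .inl rfl, fun {i j} h => ?_, fun {i j k} h h' => ?_⟩
        · exact h.imp Eq.symm fun h => (T.lcaCard_comm j i).trans_le h
        · rcases h with rfl | h
          · exact h'
          · rcases h' with rfl | h'
            · exact .inr h
            · exact .inr ((T.lcaCard_le_max i j k).trans (max_le h h')) }
  refine ⟨fun i => (Quotient.mk r i).out, fun i j hij => ?_⟩
  rw [Ne, Quotient.out_inj, Quotient.eq]
  change ¬ (i = j ∨ T.lcaCard i j ≤ s) ↔ _
  simp [hij]

open Classical in
theorem sum_lca_le_leaf [DecidableEq V] {i j : V} (hij : i ≠ j) (x : ℝ) :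
    ∑ k, (if (i ≠ j ∧ j ≠ k ∧ i ≠ k) ∧ T.lca i j ≤ T.leaf k then x else 0) =
      (T.lcaCard i j - 2 : ℕ) * x := by
  rw [← Finset.sum_filter, Finset.sum_const, nsmul_eq_mul]
  congr 2
  have : (Finset.univ.filter fun k => (i ≠ j ∧ j ≠ k ∧ i ≠ k) ∧ T.lca i j ≤ T.leaf k) =
      (Finset.univ.filter fun k => T.lca i j ≤ T.leaf k) \ {i, j} := by
    ext k
    simp [hij, eq_comm]
    tauto
  -- Both `i` and `j` lie below their own LCA, so the truncated subtraction of 2 is exact.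
  rw [this, Finset.card_sdiff_of_subset, Finset.card_pair hij, lcaCard]
  intro k
  simp only [Finset.mem_insert, Finset.mem_singleton, Finset.mem_filter, Finset.mem_univ,
    true_and]
  rintro (rfl | rfl)
  · exact T.lca_le_leaf_left _ _
  · exact T.lca_le_leaf_right _ _

end Card

end HCTree

open Classical in
/-- Twice the total cost, as a sum over ordered pairs. -/
theorem two_mul_totalCost {n : ℕ} {w : Fin n → Fin n → ℝ≥0} (hw : ∀ i j, w i j = w j i)
    (T : HCTree (Fin n)) :
    2 * (totalCost w T : ℝ) =
      ∑ i, ∑ j, if i ≠ j then ((T.lcaCard i j - 2 : ℕ) : ℝ) * w i j else 0 := by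
  have h := sum_distinct_triple fun i j k : Fin n =>
    if T.lca i j ≤ T.leaf k then (w i j : ℝ) else 0
  have e : ∀ i j, (∑ k, if i ≠ j ∧ j ≠ k ∧ i ≠ k then
      (if T.lca i j ≤ T.leaf k then (w i j : ℝ) else 0) else 0) =
      if i ≠ j then ((T.lcaCard i j - 2 : ℕ) : ℝ) * w i j else 0 := by
    intro i j
    split_ifs with hij
    · simp only [← ite_and]
      exact T.sum_lca_le_leaf hij _
    · simp [not_not.1 hij]
  simp only [e] at h
  rw [h]
  unfold totalCost
  push_cast
  simp only [Finset.mul_sum]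
  refine Finset.sum_congr rfl fun i _ => Finset.sum_congr rfl fun j _ =>
    Finset.sum_congr rfl fun k _ => ?_
  by_cases hlt : i < j ∧ j < k
  · simp only [if_pos hlt, T.tripletCost_eq, T.lca_comm j i, T.lca_comm k i, T.lca_comm k j, hw j i,
      hw k i, hw k j, NNReal.coe_add, apply_ite NNReal.toReal, NNReal.coe_zero]
    ring
  · simp [if_neg hlt]

/-! ### Trees on a complete graph -/

/-- The number of triplets. -/
theorem sum_triple_one (n : ℕ) :
    (∑ i : Fin n, ∑ j : Fin n, ∑ k : Fin n, if i < j ∧ j < k then (1 : ℝ) else 0) =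
      n * (n - 1) * (n - 2) / 6 := by
  have h := sum_distinct_triple fun _ _ _ : Fin n => (1 : ℝ)
  have e : ∀ i j k : Fin n, (if i ≠ j ∧ j ≠ k ∧ i ≠ k then (1 : ℝ) else 0) =
      1 - (if i = j then 1 else 0) - (if j = k then 1 else 0) - (if i = k then 1 else 0)
        + 2 * (if i = j then if j = k then 1 else 0 else 0) := by
    intro i j k
    by_cases h1 : i = j
    · subst h1
      by_cases h2 : i = k <;> simp [h2]
      norm_num
    · by_cases h2 : j = k
      · subst h2
        simp [h1]
      · simp [h1, h2, sub_eq_add_neg]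
        split_ifs <;> simp
  simp only [e, Finset.sum_add_distrib, Finset.sum_sub_distrib, ← Finset.mul_sum] at h
  have e' : ∀ i j : Fin n, (∑ k : Fin n, if i = j then if j = k then (1 : ℝ) else 0 else 0) =
      if i = j then 1 else 0 := by
    intro i j
    split_ifs <;> simp
  simp only [e', Finset.sum_const, Finset.card_univ, Fintype.card_fin, nsmul_eq_mul, mul_one,
    Finset.sum_ite_eq, Finset.mem_univ, if_true, ← Finset.mul_sum] at h
  have h6 : (∑ i : Fin n, ∑ j : Fin n, ∑ k : Fin n, if i < j ∧ j < k then
      (1 : ℝ) + 1 + 1 + 1 + 1 + 1 else 0) =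
      6 * ∑ i : Fin n, ∑ j : Fin n, ∑ k : Fin n, if i < j ∧ j < k then (1 : ℝ) else 0 := by
    simp only [Finset.mul_sum, mul_ite, mul_zero]
    norm_num
  rw [h6] at h
  linarith

/-- With unit weights each triplet costs 2 or 3. -/
theorem le_totalCost_one {n : ℕ} (T : HCTree (Fin n)) :
    (n * (n - 1) * (n - 2) / 3 : ℝ) ≤ totalCost (fun _ _ => 1) T := by
  have h := sum_triple_one n
  have : 2 * (∑ i : Fin n, ∑ j : Fin n, ∑ k : Fin n, if i < j ∧ j < k then (1 : ℝ) else 0) ≤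
      totalCost (fun _ _ => 1) T := by
    unfold totalCost
    push_cast
    simp only [Finset.mul_sum]
    refine Finset.sum_le_sum fun i _ => Finset.sum_le_sum fun j _ => Finset.sum_le_sum fun k _ => ?_
    by_cases hlt : i < j ∧ j < k
    · simp only [if_pos hlt, HCTree.tripletCost]
      split_ifs <;> push_cast <;> norm_num
    · simp [if_neg hlt]
  linarith

/-! ### The caterpillar tree -/

/-- The nodes of the caterpillar with `m + 1` leaves: the spine has the nodes `0, ..., m`, and one
leaf is attached to each of them. -/
@[ext]
structure CaterpillarNode (m : ℕ) where
  /-- The position on the spine. -/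
  pos : Fin (m + 1)
  /-- Whether the node is a leaf. -/
  isLeaf : Bool

namespace CaterpillarNode

variable {m : ℕ}

instance : Finite (CaterpillarNode m) :=
  Finite.of_injective (fun x : CaterpillarNode m => (x.pos, x.isLeaf)) fun x y h => by
    simp only [Prod.mk.injEq] at h
    exact CaterpillarNode.ext h.1 h.2

instance : PartialOrder (CaterpillarNode m) where
  le x y := (x.isLeaf = false ∧ x.pos ≤ y.pos) ∨ x = y
  le_refl _ := .inr rfl
  le_trans x y z := by
    rintro (⟨h1, h2⟩ | rfl) (⟨h3, h4⟩ | rfl)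
    · exact .inl ⟨h1, h2.trans h4⟩
    · exact .inl ⟨h1, h2⟩
    · exact .inl ⟨h3, h4⟩
    · exact .inr rfl
  le_antisymm x y := by
    rintro (⟨h1, h2⟩ | rfl) (⟨h3, h4⟩ | h)
    · exact CaterpillarNode.ext (le_antisymm h2 h4) (h1.trans h3.symm)
    · exact h.symm
    · rfl
    · rfl

theorem le_def {x y : CaterpillarNode m} :
    x ≤ y ↔ (x.isLeaf = false ∧ x.pos ≤ y.pos) ∨ x = y := Iff.rfl

instance : SemilatticeInf (CaterpillarNode m) where
  inf x y := ⟨min x.pos y.pos, if x.pos = y.pos then x.isLeaf && y.isLeaf else false⟩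
  inf_le_left x y := by
    obtain ⟨a, b⟩ := x
    obtain ⟨c, d⟩ := y
    by_cases h : a = c
    · subst h
      cases b <;> cases d <;> simp [le_def]
    · simp [le_def, h]
  inf_le_right x y := by
    obtain ⟨a, b⟩ := x
    obtain ⟨c, d⟩ := y
    by_cases h : a = c
    · subst h
      cases b <;> cases d <;> simp [le_def]
    · simp [le_def, h]
  le_inf x y z := by
    rintro (⟨h1, h2⟩ | rfl) (⟨h3, h4⟩ | rfl)
    · exact .inl ⟨h1, le_min h2 h4⟩
    · exact .inl ⟨h1, le_min h2 le_rfl⟩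
    · exact .inl ⟨h3, le_min le_rfl h4⟩
    · exact .inr (by simp)

instance : OrderBot (CaterpillarNode m) where
  bot := ⟨0, false⟩
  bot_le _ := .inl ⟨rfl, Fin.zero_le _⟩

/-- The parent of a node. -/
def parent (x : CaterpillarNode m) : CaterpillarNode m :=
  -- Truncated subtraction makes the root its own parent, as `PredOrder` demands of a minimal
  -- element.
  if x.isLeaf then ⟨x.pos, false⟩ else ⟨⟨x.pos - 1, by omega⟩, false⟩

theorem isLeaf_parent (x : CaterpillarNode m) : x.parent.isLeaf = false := by
  unfold parent
  split_ifs <;> rfl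

instance : PredOrder (CaterpillarNode m) where
  pred := parent
  pred_le x := by
    obtain ⟨a, b⟩ := x
    cases b
    · exact .inl ⟨rfl, Fin.le_def.2 (Nat.sub_le _ _)⟩
    · exact .inl ⟨rfl, le_rfl⟩
  min_of_le_pred {x} h := by
    obtain ⟨a, b⟩ := x
    cases b
    · have h0 : a.val ≤ a - 1 := by
        rcases h with h | h
        · exact Fin.le_def.1 h.2
        · exact (congrArg (fun x : CaterpillarNode m => x.pos.val) h).le
      have : (⟨a, false⟩ : CaterpillarNode m) = ⊥ :=
        CaterpillarNode.ext (Fin.ext (show a.val = 0 by omega)) rfl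
      rw [this]
      exact isMin_bot
    · rcases h with h | h
      · exact absurd h.1 (by simp)
      · exact absurd (congrArg isLeaf h) (by simp [isLeaf_parent])
  le_pred_of_lt {x y} h := by
    obtain ⟨a, b⟩ := x
    obtain ⟨c, d⟩ := y
    rcases le_def.1 h.le with ⟨h1, h3⟩ | h1
    · obtain rfl : b = false := h1
      refine .inl ⟨rfl, ?_⟩
      cases d
      · have : a ≠ c := by
          rintro rfl
          exact lt_irrefl _ h
        exact Fin.le_def.2 (show a.val ≤ c.val - 1 by have := Fin.le_def.1 h3; simp at this; omega)
      · exact h3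
    · exact absurd h1 h.ne

end CaterpillarNode

/-- The caterpillar tree: the leaf `i` splits off at the `i`-th node of the spine. -/
def caterpillar (m : ℕ) : HCTree (Fin (m + 1)) where
  tree := { α := CaterpillarNode m }
  finite := inferInstanceAs (Finite (CaterpillarNode m))
  leaf i := ⟨i, true⟩
  leaf_injective i j h := congrArg CaterpillarNode.pos h
  range_leaf := by
    ext x
    obtain ⟨a, b⟩ := x
    constructor
    · rintro ⟨i, h⟩ y hy
      rw [← h] at hy ⊢
      rcases CaterpillarNode.le_def.1 hy with h1 | h1
      · exact absurd h1.1 (by simp)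
      · exact h1.ge
    · intro h
      cases b
      · have := @h ⟨a, true⟩ (CaterpillarNode.le_def.2 (.inl ⟨rfl, le_rfl⟩))
        rcases CaterpillarNode.le_def.1 this with h1 | h1
        · exact absurd h1.1 (by simp)
        · exact absurd (congrArg CaterpillarNode.isLeaf h1) (by simp)
      · exact ⟨a, rfl⟩

/-- Of three leaves the one of least index splits off first, so no triplet is merged at a single
node and each costs exactly 2: the bound of `le_totalCost_one` is attained. -/
theorem totalCost_one_caterpillar (m : ℕ) :
    (totalCost (fun _ _ => 1) (caterpillar m) : ℝ) =
      ((m + 1 : ℕ) * ((m + 1 : ℕ) - 1) * ((m + 1 : ℕ) - 2) / 3 : ℝ) := by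
  have h := sum_triple_one (m + 1)
  have : 2 * (∑ i : Fin (m + 1), ∑ j : Fin (m + 1), ∑ k : Fin (m + 1),
      if i < j ∧ j < k then (1 : ℝ) else 0) = totalCost (fun _ _ => 1) (caterpillar m) := by
    unfold totalCost
    push_cast
    simp only [Finset.mul_sum]
    refine Finset.sum_congr rfl fun i _ => Finset.sum_congr rfl fun j _ =>
      Finset.sum_congr rfl fun k _ => ?_
    by_cases hlt : i < j ∧ j < k
    · have hjk : ¬ (caterpillar m).lca j k ≤ (caterpillar m).leaf i := by
        intro hle
        rcases CaterpillarNode.le_def.1 hle with h1 | h1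
        · have : min j k ≤ i := h1.2
          rw [min_eq_left hlt.2.le] at this
          exact this.not_gt hlt.1
        · have : min j k = i := congrArg CaterpillarNode.pos h1
          rw [min_eq_left hlt.2.le] at this
          exact hlt.1.ne' this
      have hij := (caterpillar m).lca_le_leaf_or j i k
      have hik := (caterpillar m).lca_le_leaf_or k i j
      rw [HCTree.lca_comm _ j i] at hij
      rw [HCTree.lca_comm _ k i, HCTree.lca_comm _ k j] at hik
      rw [if_pos hlt, if_pos hlt, HCTree.tripletCost_eq, if_neg hjk,
        if_pos (hij.resolve_right hjk), if_pos (hik.resolve_right hjk)]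
      norm_num
    · simp [if_neg hlt]
  rw [← this, h]
  ring

/-! ### Concentration for the binomial random graph -/

section Concentration

open MeasureTheory ProbabilityTheory SimpleGraph

variable {V : Type*}

/-- The law of the indicator of a single pair in the binomial random graph. -/
noncomputable abbrev edgeLaw (p : unitInterval) (e : Sym2 V) : Measure Prop :=
  unitInterval.toNNReal p • Measure.dirac (¬ e.IsDiag) +
    unitInterval.toNNReal (unitInterval.symm p) • Measure.dirac False

open Classical in
/-- The centred indicator of a pair. -/
noncomputable def centredIndicator (p : unitInterval) (P : Prop) : ℝ := (if P then 1 else 0) - p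

theorem measurable_centredIndicator (p : unitInterval) : Measurable (centredIndicator p) :=
  Measurable.of_discrete

theorem integral_centredIndicator (p : unitInterval) {e : Sym2 V} (he : ¬ e.IsDiag) :
    ∫ P, centredIndicator p P ∂edgeLaw p e = 0 := by
  rw [integral_add_measure, integral_smul_nnreal_measure, integral_smul_nnreal_measure,
    integral_dirac, integral_dirac]
  · simp [centredIndicator, he, NNReal.smul_def]
    ring
  · exact (integrable_dirac (by simp)).smul_measure_nnreal
  · exact (integrable_dirac (by simp)).smul_measure_nnreal

/-- Hoeffding's lemma for a centred variable in an interval of length 1, whose variance proxy is `(1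
/ 2) ^ 2`. -/
theorem hasSubgaussianMGF_centredIndicator (p : unitInterval) {e : Sym2 V} (he : ¬ e.IsDiag) :
    HasSubgaussianMGF (fun ω : Sym2 V → Prop => centredIndicator p (ω e)) (1 / 4)
      (Measure.infinitePi (edgeLaw p)) := by
  have h := hasSubgaussianMGF_of_mem_Icc_of_integral_eq_zero
    (μ := Measure.infinitePi (edgeLaw (V := V) p))
    (X := fun ω : Sym2 V → Prop => centredIndicator p (ω e)) (a := -p) (b := 1 - p)
    ((measurable_centredIndicator p).comp (measurable_pi_apply e)).aemeasurable
    (Filter.Eventually.of_forall fun ω => by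
      by_cases hω : ω e
      · simp [centredIndicator, hω]
      · simp [centredIndicator, hω])
    (by
      rw [← integral_centredIndicator p he,
        ← (measurePreserving_eval_infinitePi (edgeLaw (V := V) p) e).map_eq,
        integral_map (measurable_pi_apply e).aemeasurable (measurable_centredIndicator p).aestronglyMeasurable])
  convert h using 1
  norm_num

/-- Hoeffding's inequality for the number of edges in a set of pairs. -/
theorem binomialRandom_real_lt_abs_sum_le [Finite V] (p : unitInterval) (A : Finset (V × V))
    (hA : ∀ q ∈ A, q.1 ≠ q.2) (hinj : Set.InjOn (fun q : V × V => s(q.1, q.2)) A) {M t : ℝ}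
    (hM : (A.card : ℝ) ≤ M) (ht : 0 ≤ t) :
    (binomialRandom V p).real {G | t < |∑ q ∈ A, ((unitWeight G q.1 q.2 : ℝ) - p)|} ≤
      2 * Real.exp (-2 * t ^ 2 / M) := by
  classical
  rcases A.eq_empty_or_nonempty with rfl | hne
  · have : {G : SimpleGraph V | t < |∑ q ∈ (∅ : Finset (V × V)),
        ((unitWeight G q.1 q.2 : ℝ) - p)|} = ∅ := by
      ext G
      simp [ht]
    rw [this]
    simp only [measureReal_empty]
    positivity
  set μ := Measure.infinitePi (edgeLaw (V := V) p) with hμ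
  let s : Finset (Sym2 V) := A.image fun q => s(q.1, q.2)
  have hs : ∀ e ∈ s, ¬ e.IsDiag := by
    intro e he
    obtain ⟨q, hq, rfl⟩ := Finset.mem_image.1 he
    exact hA q hq
  have hcard : s.card = A.card := Finset.card_image_of_injOn hinj
  have hind : iIndepFun (fun (e : Sym2 V) (ω : Sym2 V → Prop) => centredIndicator p (ω e)) μ :=
    iIndepFun_infinitePi fun _ => measurable_centredIndicator p
  have hsub := HasSubgaussianMGF.sum_of_iIndepFun hind (s := s) (c := fun _ => 1 / 4)
    fun e he => hasSubgaussianMGF_centredIndicator p (hs e he)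
  have hexp : Real.exp (-t ^ 2 / (2 * ((∑ _e ∈ s, (1 / 4 : ℝ≥0) : ℝ≥0) : ℝ))) ≤
      Real.exp (-2 * t ^ 2 / M) := by
    have hpos : (0 : ℝ) < A.card := by exact_mod_cast hne.card_pos
    rw [Finset.sum_const, hcard]
    apply Real.exp_le_exp.2
    push_cast
    rw [nsmul_eq_mul]
    have : -t ^ 2 / (2 * ((A.card : ℝ) * (1 / 4))) = -(2 * t ^ 2 / A.card) := by
      field_simp
      norm_num
    rw [this, neg_mul, neg_div]
    gcongr
  have hup := (hsub.measure_ge_le ht).trans hexp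
  have hlow := (hsub.neg.measure_ge_le ht).trans hexp
  have hle : (binomialRandom V p).real
        {G | t < |∑ q ∈ A, ((unitWeight G q.1 q.2 : ℝ) - p)|} ≤
      μ.real ({ω | t ≤ ∑ e ∈ s, centredIndicator p (ω e)} ∪
        {ω | t ≤ (-fun ω : Sym2 V → Prop => ∑ e ∈ s, centredIndicator p (ω e)) ω}) := by
    rw [measureReal_def, binomialRandom_apply, ← measureReal_def]
    refine measureReal_mono ?_
    rintro _ ⟨G, hG, rfl⟩
    have hsum : ∑ e ∈ s, centredIndicator p (e ∈ G.edgeSet) =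
        ∑ q ∈ A, ((unitWeight G q.1 q.2 : ℝ) - p) := by
      rw [Finset.sum_image hinj]
      refine Finset.sum_congr rfl fun q _ => ?_
      simp only [centredIndicator, unitWeight, mem_edgeSet]
      split_ifs <;> simp
    rcases lt_abs.1 hG.out with h | h
    · exact .inl (by simpa only [Set.mem_ofPred_eq, hsum] using h.le)
    · exact .inr (by simpa only [Set.mem_ofPred_eq, Pi.neg_apply, hsum] using h.le)
  refine hle.trans ((measureReal_union_le _ _).trans ?_)
  linarith

/-- Only one orientation of each pair is kept, because independence holds over unordered pairs. -/
theorem sum_sum_eq_two_mul_sum_filter_lt {n : ℕ} {x : Fin n → Fin n → ℝ} (hx : ∀ i j, x i j = x j i)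
    {R : Fin n → Fin n → Prop} [DecidableRel R] (hR : ∀ i j, R i j → R j i)
    (hne : ∀ i j, R i j → i ≠ j) :
    ∑ i, ∑ j, (if R i j then x i j else 0) =
      2 * ∑ q : Fin n × Fin n with q.1 < q.2 ∧ R q.1 q.2, x q.1 q.2 := by
  rw [Finset.sum_filter, Fintype.sum_prod_type]
  have h1 : ∀ i j, (if R i j then x i j else 0) =
      (if i < j ∧ R i j then x i j else 0) + (if j < i ∧ R j i then x j i else 0) := by
    intro i j
    by_cases hij : R i j
    · have hji := hR i j hij
      rcases (hne i j hij).lt_or_gt with h | h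
      · simp [hij, h, h.not_gt]
      · simp [hij, hji, h, h.not_gt, hx i j]
    · have hji : ¬ R j i := fun h => hij (hR j i h)
      simp [hij, hji]
  simp only [h1, Finset.sum_add_distrib]
  rw [Finset.sum_comm (f := fun i j => if j < i ∧ R j i then x j i else 0)]
  ring

theorem injOn_sym2_mk_of_lt {α : Type*} [PartialOrder α] {A : Set (α × α)}
    (hA : ∀ q ∈ A, q.1 < q.2) : Set.InjOn (fun q : α × α => s(q.1, q.2)) A := by
  rintro ⟨a, b⟩ hq ⟨c, d⟩ hr h
  have h1 : a < b := hA _ hq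
  have h2 : c < d := hA _ hr
  rcases Sym2.eq_iff.1 h with ⟨rfl, rfl⟩ | ⟨rfl, rfl⟩
  · rfl
  · exact absurd h1 h2.not_gt

/-- A weight matrix behaves like the constant matrix `p`, with deviation `u` from the mean for
every degree, and of the corresponding order for the weight across every partition and inside every
set of points. -/
structure IsQuasirandom {n : ℕ} (w : Fin n → Fin n → ℝ) (p u : ℝ) : Prop where
  partition : ∀ f : Fin n → Fin n, |∑ i, ∑ j, (if f i ≠ f j then w i j - p else 0)| ≤ 2 * (n * u)
  degree : ∀ v, |∑ j with v ≠ j, (w v j - p)| ≤ u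
  inside : ∀ S : Finset (Fin n),
    |∑ i, ∑ j, (if i ∈ S ∧ j ∈ S ∧ i ≠ j then w i j - p else 0)| ≤ 2 * (S.card * u)

theorem unitWeight_comm (G : SimpleGraph V) (i j : V) : unitWeight G i j = unitWeight G j i := by
  unfold unitWeight
  rw [G.adj_comm]

/-- Hoeffding's inequality for the number of edges in a symmetric relation. -/
theorem binomialRandom_real_lt_abs_sum_sum_le {n : ℕ} (p : unitInterval)
    {R : Fin n → Fin n → Prop} [DecidableRel R] (hR : ∀ i j, R i j → R j i)
    (hne : ∀ i j, R i j → i ≠ j) {M t : ℝ}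
    (hM : ((Finset.univ.filter fun q : Fin n × Fin n => R q.1 q.2).card : ℝ) ≤ M) (ht : 0 ≤ t) :
    (binomialRandom (Fin n) p).real
      {G | 2 * t < |∑ i, ∑ j, (if R i j then (unitWeight G i j : ℝ) - p else 0)|} ≤
      2 * Real.exp (-2 * t ^ 2 / M) := by
  refine le_trans (measureReal_mono ?_) (binomialRandom_real_lt_abs_sum_le p
    (Finset.univ.filter fun q : Fin n × Fin n => q.1 < q.2 ∧ R q.1 q.2) ?_ ?_ (M := M) ?_ ht)
  · intro G hG
    rw [Set.mem_ofPred_eq, sum_sum_eq_two_mul_sum_filter_lt (fun i j => by rw [unitWeight_comm])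
      hR hne, abs_mul, abs_two] at hG
    exact lt_of_mul_lt_mul_left hG zero_le_two
  · intro q hq
    exact (Finset.mem_filter.1 hq).2.1.ne
  · exact injOn_sym2_mk_of_lt fun q hq => (Finset.mem_filter.1 hq).2.1
  · refine le_trans ?_ hM
    exact_mod_cast Finset.card_le_card fun q hq => by
      simp only [Finset.mem_filter, Finset.mem_univ, true_and] at hq ⊢
      exact hq.2

/-- A union bound. Each labelling or vertex set fails with probability at most `2 * n ^ (-2n)`,
which beats the `n ^ n` labellings and the `2 ^ n` sets; each degree fails with probability at most
`2 / n ^ 2`. The three families contribute `2 / n` each. -/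
theorem binomialRandom_real_not_isQuasirandom_le {n : ℕ} (hn : 2 ≤ n) (p : unitInterval) :
    (binomialRandom (Fin n) p).real
      {G | ¬ IsQuasirandom (fun i j => (unitWeight G i j : ℝ)) p √(n * Real.log n)} ≤ 6 / n := by
  set μ := binomialRandom (Fin n) p
  set u := √(n * Real.log n) with hu
  have hn1 : (1 : ℝ) ≤ n := by exact_mod_cast (by omega : 1 ≤ n)
  have hn0 : (0 : ℝ) < n := by linarith
  have hlog : 0 ≤ Real.log n := Real.log_nonneg hn1
  have hu0 : 0 ≤ u := Real.sqrt_nonneg _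
  have hu2 : u ^ 2 = n * Real.log n := Real.sq_sqrt (by positivity)
  let B (f : Fin n → Fin n) : Set (SimpleGraph (Fin n)) :=
    {G | 2 * (n * u) < |∑ i, ∑ j, (if f i ≠ f j then (unitWeight G i j : ℝ) - p else 0)|}
  let C (v : Fin n) : Set (SimpleGraph (Fin n)) :=
    {G | u < |∑ j with v ≠ j, ((unitWeight G v j : ℝ) - p)|}
  let D (S : Finset (Fin n)) : Set (SimpleGraph (Fin n)) :=
    {G | 2 * (S.card * u) <
      |∑ i, ∑ j, (if i ∈ S ∧ j ∈ S ∧ i ≠ j then (unitWeight G i j : ℝ) - p else 0)|}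
  have hexp : Real.exp (n * Real.log n) = (n : ℝ) ^ n := by
    rw [mul_comm, Real.exp_mul, Real.exp_log hn0, Real.rpow_natCast]
  have hinv : Real.exp (-Real.log n) = 1 / n := by
    rw [Real.exp_neg, Real.exp_log hn0, one_div]
  have hpow : (n : ℝ) ^ n * (2 * Real.exp (-2 * u ^ 2)) ≤ 2 / n := by
    rw [← hexp, mul_left_comm, ← Real.exp_add, hu2, div_eq_mul_one_div (2 : ℝ), ← hinv]
    gcongr
    nlinarith
  have hB : ∀ f, μ.real (B f) ≤ 2 * Real.exp (-2 * u ^ 2) := by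
    intro f
    have h := binomialRandom_real_lt_abs_sum_sum_le p (R := fun i j => f i ≠ f j)
      (fun i j h => h.symm) (fun i j h => by rintro rfl; exact h rfl) (M := (n : ℝ) ^ 2)
      (t := n * u) (by
        refine le_trans (Nat.cast_le.2 (Finset.card_le_univ _)) ?_
        simp [sq]) (by positivity)
    have e : -2 * (n * u) ^ 2 / (n : ℝ) ^ 2 = -2 * u ^ 2 := by field_simp
    rwa [e] at h
  have hD : ∀ S, μ.real (D S) ≤ 2 * Real.exp (-2 * u ^ 2) := by
    intro S
    rcases S.eq_empty_or_nonempty with rfl | hS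
    · have : D ∅ = ∅ := by
        ext G
        simp [D]
      rw [this]
      simp only [measureReal_empty]
      positivity
    have hS0 : (0 : ℝ) < S.card := by exact_mod_cast hS.card_pos
    have h := binomialRandom_real_lt_abs_sum_sum_le p (R := fun i j => i ∈ S ∧ j ∈ S ∧ i ≠ j)
      (fun i j h => ⟨h.2.1, h.1, h.2.2.symm⟩) (fun i j h => h.2.2) (M := (S.card : ℝ) ^ 2)
      (t := S.card * u) (by
        have : (Finset.univ.filter fun q : Fin n × Fin n => q.1 ∈ S ∧ q.2 ∈ S ∧ q.1 ≠ q.2) ⊆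
            S ×ˢ S := fun q hq => by
          simp only [Finset.mem_filter, Finset.mem_univ, true_and] at hq
          exact Finset.mem_product.2 ⟨hq.1, hq.2.1⟩
        refine le_trans (Nat.cast_le.2 (Finset.card_le_card this)) ?_
        simp [sq]) (by positivity)
    have e : -2 * (S.card * u) ^ 2 / (S.card : ℝ) ^ 2 = -2 * u ^ 2 := by field_simp
    rwa [e] at h
  have hC : ∀ v, μ.real (C v) ≤ 2 * Real.exp (-2 * Real.log n) := by
    intro v
    have h := binomialRandom_real_lt_abs_sum_le p
      ((Finset.univ.filter fun j => v ≠ j).image fun j => (v, j))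
      (fun q hq => by
        obtain ⟨j, hj, rfl⟩ := Finset.mem_image.1 hq
        exact (Finset.mem_filter.1 hj).2)
      (fun q hq r hr h => by
        obtain ⟨j, hj, rfl⟩ := Finset.mem_image.1 hq
        obtain ⟨k, hk, rfl⟩ := Finset.mem_image.1 hr
        have : j = k := Sym2.congr_right.1 h
        rw [this])
      (M := n) (t := u) (by
        refine le_trans (Nat.cast_le.2 (Finset.card_image_le.trans (Finset.card_le_univ _))) ?_
        simp) hu0
    have e : -2 * u ^ 2 / (n : ℝ) = -2 * Real.log n := by
      rw [hu2]
      field_simp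
    rw [e] at h
    simpa only [Finset.sum_image fun j _ k _ h => (Prod.mk.inj h).2] using h
  have hsub : {G : SimpleGraph (Fin n) | ¬ IsQuasirandom (fun i j => (unitWeight G i j : ℝ)) p u} ⊆
      ((⋃ f, B f) ∪ ⋃ v, C v) ∪ ⋃ S, D S := by
    intro G hG
    by_contra hcon
    simp only [Set.mem_union, Set.mem_iUnion, not_or, not_exists] at hcon
    exact hG ⟨fun f => not_lt.1 (hcon.1.1 f), fun v => not_lt.1 (hcon.1.2 v),
      fun S => not_lt.1 (hcon.2 S)⟩
  have h1 : μ.real (⋃ f, B f) ≤ 2 / n := by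
    refine (measureReal_iUnion_fintype_le _).trans ((Finset.sum_le_sum fun f _ => hB f).trans ?_)
    rw [Finset.sum_const, nsmul_eq_mul, Finset.card_univ, Fintype.card_fun, Fintype.card_fin,
      Nat.cast_pow]
    exact hpow
  have h2 : μ.real (⋃ v, C v) ≤ 2 / n := by
    refine (measureReal_iUnion_fintype_le _).trans ((Finset.sum_le_sum fun f _ => hC f).trans ?_)
    rw [Finset.sum_const, nsmul_eq_mul, Finset.card_univ, Fintype.card_fin,
      show -2 * Real.log n = -Real.log n + -Real.log n by ring, Real.exp_add, hinv]
    apply le_of_eq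
    field_simp
  have h3 : μ.real (⋃ S, D S) ≤ 2 / n := by
    refine (measureReal_iUnion_fintype_le _).trans ((Finset.sum_le_sum fun f _ => hD f).trans ?_)
    rw [Finset.sum_const, nsmul_eq_mul, Finset.card_univ, Fintype.card_finset, Fintype.card_fin,
      Nat.cast_pow]
    refine le_trans ?_ hpow
    gcongr
  calc _ ≤ _ := measureReal_mono hsub
    _ ≤ _ := measureReal_union_le _ _
    _ ≤ _ := add_le_add_left (measureReal_union_le _ _) _
    _ ≤ (2 / n + 2 / n) + 2 / n := add_le_add (add_le_add h1 h2) h3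
    _ = 6 / n := by ring

end Concentration

/-! ### Costs on quasirandom graphs -/

theorem IsQuasirandom.abs_totalCost_sub_le {n : ℕ} {w : Fin n → Fin n → ℝ≥0}
    (hw : ∀ i j, w i j = w j i) {p u : ℝ} (h : IsQuasirandom (fun i j => (w i j : ℝ)) p u)
    (T : HCTree (Fin n)) :
    |(totalCost w T : ℝ) - p * totalCost (fun _ _ => 1) T| ≤ n * (n * u) := by
  classical
  have h1 := two_mul_totalCost hw T
  have h2 := two_mul_totalCost (w := fun _ _ => 1) (fun _ _ => rfl) T
  choose f hf using T.exists_label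
  -- Layer-cake formula: `lcaCard - 2` is the number of `s < n` with `s + 2 < lcaCard`, and for
  -- fixed `s` these pairs are the ones cut by the partition into clusters of size at most `s + 2`.
  have hdiff : 2 * ((totalCost w T : ℝ) - p * totalCost (fun _ _ => 1) T) =
      ∑ s ∈ Finset.range n, ∑ i, ∑ j, if f (s + 2) i ≠ f (s + 2) j then (w i j : ℝ) - p else 0 := by
    rw [mul_sub, mul_left_comm, h1, h2, Finset.mul_sum, ← Finset.sum_sub_distrib, Finset.sum_comm]
    refine Finset.sum_congr rfl fun i _ => ?_
    rw [Finset.mul_sum, ← Finset.sum_sub_distrib, Finset.sum_comm]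
    refine Finset.sum_congr rfl fun j _ => ?_
    by_cases hij : i = j
    · subst hij
      simp
    · have hle : T.lcaCard i j ≤ n := (T.lcaCard_le i j).trans_eq (Fintype.card_fin n)
      have : ∀ s ∈ Finset.range n, (if f (s + 2) i ≠ f (s + 2) j then (w i j : ℝ) - p else 0) =
          if s < T.lcaCard i j - 2 then (w i j : ℝ) - p else 0 := by
        intro s _
        simp only [hf _ i j hij]
        congr 1
        exact propext (by omega)
      rw [Finset.sum_congr rfl this, ← Finset.sum_filter, Finset.sum_const, nsmul_eq_mul]
      have hcard : ((Finset.range n).filter fun s => s < T.lcaCard i j - 2) =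
          Finset.range (T.lcaCard i j - 2) := by
        ext s
        simp only [Finset.mem_filter, Finset.mem_range]
        omega
      rw [hcard, Finset.card_range, if_pos hij, if_pos hij]
      push_cast
      ring
  have hbound : |2 * ((totalCost w T : ℝ) - p * totalCost (fun _ _ => 1) T)| ≤
      n * (2 * (n * u)) := by
    rw [hdiff]
    refine (Finset.abs_sum_le_sum_abs _ _).trans
      ((Finset.sum_le_sum fun s _ => h.partition (f (s + 2))).trans_eq ?_)
    rw [Finset.sum_const, nsmul_eq_mul, Finset.card_range]
  rw [abs_mul, abs_two] at hbound
  linarith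

section Graph

variable {n : ℕ} (G : SimpleGraph (Fin n))

open Classical in
-- The minimum is 0, 1 or 2 according as there are at most one, two or three edges; in a triangle
-- the three products of pairs overcount by one.
theorem minTripletCost_unitWeight (i j k : Fin n) :
    (minTripletCost (unitWeight G) i j k : ℝ) =
      unitWeight G i j * unitWeight G i k + unitWeight G i j * unitWeight G j k +
        unitWeight G i k * unitWeight G j k -
        unitWeight G i j * unitWeight G i k * unitWeight G j k := by
  unfold minTripletCost unitWeight
  split_ifs <;> norm_num

theorem sum_sum_mem_ne {α : Type*} [Fintype α] [DecidableEq α] (S : Finset α) :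
    ∑ i, ∑ j, (if i ∈ S ∧ j ∈ S ∧ i ≠ j then (1 : ℝ) else 0) = (S.card : ℝ) ^ 2 - S.card := by
  have e : ∀ i j, (if i ∈ S ∧ j ∈ S ∧ i ≠ j then (1 : ℝ) else 0) =
      (if i ∈ S then if j ∈ S then 1 else 0 else 0) -
        (if i = j then if i ∈ S then 1 else 0 else 0) := by
    intro i j
    by_cases h1 : i ∈ S <;> by_cases h2 : i = j
    · subst h2; simp [h1]
    · simp [h1, h2]
    · subst h2; simp [h1]
    · simp [h1, h2]
  simp [e, Finset.sum_ite_irrel, sq]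

open Classical in
/-- Six times the base cost of a graph, in terms of the degrees and of the edges inside the
neighbourhoods. -/
theorem six_mul_baseCost :
    6 * (baseCost (unitWeight G) : ℝ) = ∑ i, ∑ j, ∑ k,
      if j ∈ Finset.univ.filter (G.Adj i) ∧ k ∈ Finset.univ.filter (G.Adj i) ∧ j ≠ k
        then 3 - (unitWeight G j k : ℝ) else 0 := by
  have h := sum_distinct_triple fun i j k : Fin n =>
    (3 * (unitWeight G i j * unitWeight G i k) -
      unitWeight G i j * unitWeight G i k * unitWeight G j k : ℝ)
  have hl : ∀ i j k : Fin n, (if j ∈ Finset.univ.filter (G.Adj i) ∧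
      k ∈ Finset.univ.filter (G.Adj i) ∧ j ≠ k then 3 - (unitWeight G j k : ℝ) else 0) =
      if i ≠ j ∧ j ≠ k ∧ i ≠ k then (3 * (unitWeight G i j * unitWeight G i k) -
        unitWeight G i j * unitWeight G i k * unitWeight G j k : ℝ) else 0 := by
    intro i j k
    simp only [Finset.mem_filter, Finset.mem_univ, true_and]
    by_cases h1 : G.Adj i j
    · by_cases h2 : G.Adj i k
      · simp [unitWeight, h1, h2, h1.ne, h2.ne]
      · simp [unitWeight, h2]
    · simp [unitWeight, h1]
  simp only [hl]
  rw [h]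
  unfold baseCost
  push_cast
  simp only [Finset.mul_sum]
  refine Finset.sum_congr rfl fun i _ => Finset.sum_congr rfl fun j _ =>
    Finset.sum_congr rfl fun k _ => ?_
  by_cases hlt : i < j ∧ j < k
  · rw [if_pos hlt, if_pos hlt, minTripletCost_unitWeight, unitWeight_comm G j i,
      unitWeight_comm G k i, unitWeight_comm G k j]
    ring
  · simp [if_neg hlt]

variable {G} {p u : ℝ}

open Classical in
theorem IsQuasirandom.abs_card_sub_le
    (h : IsQuasirandom (fun i j => (unitWeight G i j : ℝ)) p u) (i : Fin n) :
    |((Finset.univ.filter (G.Adj i)).card : ℝ) - p * (n - 1)| ≤ u := by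
  have hdeg := h.degree i
  rw [Finset.sum_sub_distrib, Finset.sum_const, nsmul_eq_mul, Finset.filter_ne,
    Finset.card_erase_of_mem (Finset.mem_univ i), Finset.card_univ, Fintype.card_fin,
    Nat.cast_pred (Nat.pos_of_ne_zero (by rintro rfl; exact i.elim0))] at hdeg
  have : ∑ j ∈ Finset.univ.erase i, (unitWeight G i j : ℝ) =
      (Finset.univ.filter (G.Adj i)).card := by
    rw [Finset.sum_erase _ (by simp [unitWeight])]
    simp [unitWeight, apply_ite NNReal.toReal]
  rw [this] at hdeg
  rwa [mul_comm p]

open Classical in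
-- The bound `inside` is applied to each neighbourhood. Neighbourhoods depend on the graph, which is
-- why that bound is required for all sets at once.
theorem IsQuasirandom.abs_baseCost_sub_le
    (h : IsQuasirandom (fun i j => (unitWeight G i j : ℝ)) p u) :
    |6 * (baseCost (unitWeight G) : ℝ) - (3 - p) * ∑ i,
      (((Finset.univ.filter (G.Adj i)).card : ℝ) ^ 2 - (Finset.univ.filter (G.Adj i)).card)| ≤
      ∑ i, 2 * ((Finset.univ.filter (G.Adj i)).card * u) := by
  rw [six_mul_baseCost, Finset.mul_sum, ← Finset.sum_sub_distrib]
  refine (Finset.abs_sum_le_sum_abs _ _).trans (Finset.sum_le_sum fun i _ => ?_)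
  rw [← sum_sum_mem_ne, Finset.mul_sum, ← Finset.sum_sub_distrib]
  refine le_trans (le_of_eq ?_) (h.inside (Finset.univ.filter (G.Adj i)))
  rw [← abs_neg, ← Finset.sum_neg_distrib]
  congr 1
  refine Finset.sum_congr rfl fun j _ => ?_
  rw [Finset.mul_sum, ← Finset.sum_sub_distrib, ← Finset.sum_neg_distrib]
  refine Finset.sum_congr rfl fun k _ => ?_
  split_ifs <;> ring

end Graph

/-! ### Relative errors and the quotient of the two costs. -/

section Ratio

variable {n : ℕ} {G : SimpleGraph (Fin n)} {p u s : ℝ}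

theorem ratioCost_eq_coe {w : Fin n → Fin n → ℝ≥0} (hw : baseCost w ≠ 0) (T : HCTree (Fin n)) :
    ratioCost w T = ((totalCost w T / baseCost w : ℝ≥0) : ℝ≥0∞) := by
  unfold ratioCost
  rw [if_neg fun h => hw h.2, ENNReal.coe_div hw]

theorem IsQuasirandom.abs_baseCost_sub_le_mul
    (h : IsQuasirandom (fun i j => (unitWeight G i j : ℝ)) p u) (hp0 : 0 < p) (hp1 : p ≤ 1)
    (hu : 0 ≤ u) (hn : 0 < n) (hs : u + 1 = s * (p * n)) (hs1 : s ≤ 1 / 20) :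
    |6 * (baseCost (unitWeight G) : ℝ) - (3 - p) * (n * (p * n) ^ 2)| ≤
      10 * s * ((3 - p) * (n * (p * n) ^ 2)) := by
  classical
  have hn0 : (0 : ℝ) < n := by exact_mod_cast hn
  set q : ℝ := p * n with hq
  have hq0 : 0 < q := by positivity
  have hs0 : 0 < s := by
    by_contra hneg
    nlinarith
  -- The summand 1 in `u + 1` pays for replacing `n - 1` by `n` in the mean degree, and makes the
  -- linear term `d i` an error of order `s * q ^ 2`.
  have hsq : 1 ≤ s * q := by linarith
  set d : Fin n → ℝ := fun i => ((Finset.univ.filter (G.Adj i)).card : ℝ) with hd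
  have hd1 : ∀ i, |d i - q| ≤ s * q := by
    intro i
    have h1 := abs_le.1 (h.abs_card_sub_le i)
    rw [mul_sub, mul_one, ← hq] at h1
    rw [abs_le]
    constructor <;> simp only [hd] <;> linarith [h1.1, h1.2]
  have hd2 : ∀ i, d i ≤ 2 * q := by
    intro i
    have := (abs_le.1 (hd1 i)).2
    nlinarith
  have hd0 : ∀ i, 0 ≤ d i := fun i => Nat.cast_nonneg _
  have hd3 : ∀ i, |d i ^ 2 - d i - q ^ 2| ≤ 5 * s * q ^ 2 := by
    intro i
    have h1 : |d i ^ 2 - q ^ 2| ≤ s * q * (3 * q) := by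
      rw [show d i ^ 2 - q ^ 2 = (d i - q) * (d i + q) by ring, abs_mul]
      refine mul_le_mul (hd1 i) ?_ (abs_nonneg _) (by positivity)
      rw [abs_of_nonneg (by linarith [hd0 i])]
      linarith [hd2 i]
    have h2 : d i ≤ 2 * s * q ^ 2 := by
      have := hd2 i
      nlinarith
    rw [abs_le] at h1 ⊢
    constructor <;> nlinarith [hd0 i, h1.1, h1.2]
  have hsum : |∑ i, (d i ^ 2 - d i) - n * q ^ 2| ≤ n * (5 * s * q ^ 2) := by
    have e : ∑ i, (d i ^ 2 - d i) - n * q ^ 2 = ∑ i, (d i ^ 2 - d i - q ^ 2) := by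
      rw [Finset.sum_sub_distrib (g := fun _ => q ^ 2)]
      simp
    rw [e]
    refine (Finset.abs_sum_le_sum_abs _ _).trans ((Finset.sum_le_sum fun i _ => hd3 i).trans ?_)
    simp
  have hlast : ∑ i, 2 * (d i * u) ≤ n * (4 * s * q ^ 2) := by
    have : ∀ i, 2 * (d i * u) ≤ 4 * s * q ^ 2 := by
      intro i
      have h1 : d i * u ≤ 2 * q * (s * q) := by
        refine mul_le_mul (hd2 i) ?_ hu (by positivity)
        linarith
      linarith
    refine (Finset.sum_le_sum fun i _ => this i).trans ?_
    simp
  have hB := h.abs_baseCost_sub_le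
  have h3 : |(3 - p) * ∑ i, (d i ^ 2 - d i) - (3 - p) * (n * q ^ 2)| ≤ 3 * (n * (5 * s * q ^ 2)) := by
    rw [← mul_sub, abs_mul, abs_of_nonneg (by linarith : (0 : ℝ) ≤ 3 - p)]
    exact mul_le_mul (by linarith) hsum (abs_nonneg _) (by norm_num)
  have h4 := abs_sub_le (6 * (baseCost (unitWeight G) : ℝ)) ((3 - p) * ∑ i, (d i ^ 2 - d i))
    ((3 - p) * (n * q ^ 2))
  -- The errors add up to `(15 + 4) * s * n * q ^ 2`, and `2 ≤ 3 - p` turns this into relative error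
  -- `10 * s`.
  have h5 : 2 * (s * (n * q ^ 2)) ≤ (3 - p) * (s * (n * q ^ 2)) :=
    mul_le_mul_of_nonneg_right (by linarith) (by positivity)
  have h6 : 0 ≤ s * (n * q ^ 2) := by positivity
  have hB' := hB.trans hlast
  linarith

/-- Half of the loss `6 * s` is the deviation from the complete graph; the other half covers `n ^ 2
- (n - 1) * (n - 2) ≤ 3 * n`. -/
theorem IsQuasirandom.le_totalCost
    (h : IsQuasirandom (fun i j => (unitWeight G i j : ℝ)) p u) (hp0 : 0 < p) (hp1 : p ≤ 1)
    (hu : 0 ≤ u) (hs : u + 1 = s * (p * n)) (T : HCTree (Fin n)) :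
    (p * n) * n ^ 2 * (1 - 6 * s) ≤ 3 * (totalCost (unitWeight G) T : ℝ) := by
  have h1 := (abs_le.1 (h.abs_totalCost_sub_le (unitWeight_comm G) T)).1
  have h2 := mul_le_mul_of_nonneg_left (le_totalCost_one T) hp0.le
  have hn0 : (0 : ℝ) ≤ n := Nat.cast_nonneg n
  have hpn : p * n ≤ n := by nlinarith
  have h3 : (n : ℝ) * (n * u) ≤ n * (n * (s * (p * n))) := by gcongr; linarith
  have h4 : (p * n) * n ≤ (p * n) * n * (s * (p * n)) := le_mul_of_one_le_right (by positivity)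
    (by linarith)
  have hs0 : 0 ≤ s * (p * n) := by linarith
  have h5 : (p * n) * n * (s * (p * n)) ≤ n * n * (s * (p * n)) := by gcongr
  have h6 : 0 ≤ p * n := by positivity
  nlinarith

theorem IsQuasirandom.totalCost_caterpillar_le {m : ℕ} {G : SimpleGraph (Fin (m + 1))}
    (h : IsQuasirandom (fun i j => (unitWeight G i j : ℝ)) p u) (hp0 : 0 < p)
    (hs : u + 1 = s * (p * (m + 1 : ℕ))) :
    3 * (totalCost (unitWeight G) (caterpillar m) : ℝ) ≤
      (p * (m + 1 : ℕ)) * (m + 1 : ℕ) ^ 2 * (1 + 3 * s) := by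
  have h1 := (abs_le.1 (h.abs_totalCost_sub_le (unitWeight_comm G) (caterpillar m))).2
  rw [totalCost_one_caterpillar] at h1
  have hN1 : (1 : ℝ) ≤ (m + 1 : ℕ) := by exact_mod_cast Nat.le_add_left 1 m
  generalize ((m + 1 : ℕ) : ℝ) = N at *
  have h3 : N * (N * u) ≤ N * (N * (s * (p * N))) := by gcongr; linarith
  have h6 : 0 ≤ p * N := by positivity
  nlinarith

/-- The optimal ratio-cost of a quasirandom graph. -/
theorem IsQuasirandom.optimalRatioCost_approx
    (h : IsQuasirandom (fun i j => (unitWeight G i j : ℝ)) p u) (hp0 : 0 < p) (hp1 : p ≤ 1)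
    (hu : 0 ≤ u) (hn : 0 < n) (hs : u + 1 = s * (p * n)) (hs1 : s ≤ 1 / 20) :
    optimalRatioCost (unitWeight G) ≠ ∞ ∧
      |(optimalRatioCost (unitWeight G)).toReal - 2 / (3 * p - p ^ 2)| ≤
        26 * s * (2 / (3 * p - p ^ 2)) := by
  obtain ⟨m, rfl⟩ : ∃ m, n = m + 1 := ⟨n - 1, by omega⟩
  have hB := abs_le.1 (h.abs_baseCost_sub_le_mul hp0 hp1 hu hn hs hs1)
  have hlow := h.le_totalCost hp0 hp1 hu hs
  have hup := h.totalCost_caterpillar_le hp0 hs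
  have hN : (0 : ℝ) < (m + 1 : ℕ) := by exact_mod_cast hn
  have hs0 : 0 < s := by
    by_contra hneg
    have : 0 < p * (m + 1 : ℕ) := by positivity
    nlinarith
  set N : ℝ := ((m + 1 : ℕ) : ℝ)
  set b : ℝ := (baseCost (unitWeight G) : ℝ) with hb
  have h3p : 0 < 3 - p := by linarith
  set R : ℝ := 2 / (3 * p - p ^ 2) with hR
  have hR0 : 0 < R := by
    have : 0 < 3 * p - p ^ 2 := by nlinarith
    positivity
  -- `R` is the quotient of the main terms of `6 * totalCost` and `6 * baseCost`.
  have hRe : R * ((3 - p) * (N * (p * N) ^ 2)) = 2 * ((p * N) * N ^ 2) := by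
    have e : 3 * p - p ^ 2 = (3 - p) * p := by ring
    rw [hR, e]
    field_simp
  set X : ℝ := (p * N) * N ^ 2 with hX
  have hX0 : 0 < X := by positivity
  have hRb1 : R * (6 * b) ≤ 2 * X * (1 + 10 * s) := by
    have := mul_le_mul_of_nonneg_left hB.2 hR0.le
    nlinarith
  have hRb2 : 2 * X * (1 - 10 * s) ≤ R * (6 * b) := by
    have := mul_le_mul_of_nonneg_left hB.1 hR0.le
    nlinarith
  have hb0 : 0 < b := by
    have h1 : 0 < 2 * X * (1 - 10 * s) := mul_pos (by positivity) (by linarith)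
    have h2 : 0 < R * (6 * b) := h1.trans_le hRb2
    have := pos_of_mul_pos_right h2 hR0.le
    linarith
  have hbne : baseCost (unitWeight G) ≠ 0 := by
    intro h0
    rw [hb, h0] at hb0
    exact lt_irrefl _ hb0
  have : Nonempty (HCTree (Fin (m + 1))) := ⟨caterpillar m⟩
  obtain ⟨T, hT⟩ := exists_ratioCost_eq_optimalRatioCost (unitWeight G)
  have hle : optimalRatioCost (unitWeight G) ≤ ratioCost (unitWeight G) (caterpillar m) :=
    iInf_le _ _
  rw [← hT, ratioCost_eq_coe hbne, ratioCost_eq_coe hbne, ENNReal.coe_le_coe,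
    ← NNReal.coe_le_coe, NNReal.coe_div, NNReal.coe_div] at hle
  rw [← hT, ratioCost_eq_coe hbne]
  refine ⟨ENNReal.coe_ne_top, ?_⟩
  rw [ENNReal.coe_toReal, NNReal.coe_div]
  -- The constants fit together here: `(1 - 10s)(1 + 26s) ≥ 1 + 3s` for `s ≥ 0` is equivalent, when
  -- `s > 0`, to `s ≤ 1 / 20`. The lower bound needs only `(1 + 10s)(1 - 16s) ≤ 1 - 6s`.
  have hXs : 0 ≤ X * s * (1 - 20 * s) :=
    mul_nonneg (by positivity) (by linarith)
  have h1 : R * (1 - 26 * s) ≤ totalCost (unitWeight G) T / b := by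
    rw [le_div_iff₀ hb0]
    have h2 := hlow T
    have h3 : R * (6 * b) * (1 - 16 * s) ≤ 2 * X * (1 + 10 * s) * (1 - 16 * s) :=
      mul_le_mul_of_nonneg_right hRb1 (by linarith)
    have h4 : 0 ≤ R * b * s := by positivity
    have h5 : 0 ≤ X * s ^ 2 := by positivity
    nlinarith
  have h2 : (totalCost (unitWeight G) T : ℝ) / b ≤ R * (1 + 26 * s) := by
    refine hle.trans ?_
    rw [div_le_iff₀ hb0]
    have h3 : 2 * X * (1 - 10 * s) * (1 + 26 * s) ≤ R * (6 * b) * (1 + 26 * s) :=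
      mul_le_mul_of_nonneg_right hRb2 (by linarith)
    nlinarith
  rw [abs_le]
  constructor <;> linarith

end Ratio

/-! ### The limit for the binomial random graph. -/

theorem mainTheorem7 :
    ∃ ε : ℝ, 0 < ε ∧
      ∀ p : ℕ → unitInterval,
        (fun n : ℕ => Real.sqrt (Real.log (n : ℝ) / (n : ℝ))) =o[atTop] (fun n => (p n : ℝ)) →
        ∃ δ : ℕ → ℝ, Tendsto δ atTop (𝓝 0) ∧
          ∀ᶠ n : ℕ in atTop,
            1 - (n : ℝ) ^ (-ε) <
              (SimpleGraph.binomialRandom (Fin n) (p n)).real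
                {G | optimalRatioCost (unitWeight G) ≠ ∞ ∧
                  |(optimalRatioCost (unitWeight G)).toReal -
                      2 / (3 * (p n : ℝ) - (p n : ℝ) ^ 2)| ≤
                    δ n * (2 / (3 * (p n : ℝ) - (p n : ℝ) ^ 2))} := by
  -- Any exponent below 1 would do, as the failure probability is at most `6 / n`; for `1 / 2` the
  -- comparison holds once `n > 36`.
  refine ⟨1 / 2, by norm_num, fun p hp => ?_⟩
  let s : ℕ → ℝ := fun n => (√(n * Real.log n) + 1) / ((p n : ℝ) * n)
  have hppos : ∀ᶠ n : ℕ in atTop, 0 < (p n : ℝ) := by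
    filter_upwards [hp.bound one_pos, eventually_ge_atTop 2] with n hn hn2
    have hn1 : (1 : ℝ) < n := by exact_mod_cast hn2
    have hlog : 0 < Real.log n := Real.log_pos hn1
    rw [one_mul, Real.norm_of_nonneg (Real.sqrt_nonneg _), Real.norm_of_nonneg (p n).2.1] at hn
    exact (Real.sqrt_pos.2 (div_pos hlog (by linarith))).trans_le hn
  have hs : Tendsto s atTop (𝓝 0) := by
    have h0 : Tendsto (fun n : ℕ => 2 * (√(Real.log n / n) / (p n : ℝ))) atTop (𝓝 0) := by
      simpa using hp.tendsto_div_nhds_zero.const_mul 2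
    refine squeeze_zero' ?_ ?_ h0
    · exact Eventually.of_forall fun n =>
        div_nonneg (by positivity) (mul_nonneg (p n).2.1 (Nat.cast_nonneg n))
    · filter_upwards [hppos, eventually_ge_atTop 3] with n hpn hn
      have hn3 : (3 : ℝ) ≤ n := by exact_mod_cast hn
      have hlog : 1 ≤ Real.log n := by
        rw [Real.le_log_iff_exp_le (by linarith)]
        exact Real.exp_one_lt_three.le.trans hn3
      have hsqrt : 1 ≤ √(n * Real.log n) := by
        rw [Real.one_le_sqrt]
        nlinarith
      have e : √(n * Real.log n) = n * √(Real.log n / n) := by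
        rw [show (n : ℝ) * Real.log n = n ^ 2 * (Real.log n / n) by field_simp,
          Real.sqrt_mul (by positivity), Real.sqrt_sq (by linarith)]
      calc s n ≤ (2 * √(n * Real.log n)) / ((p n : ℝ) * n) := by
            have : 0 < (p n : ℝ) * n := mul_pos hpn (by linarith)
            simp only [s]
            gcongr
            linarith
        _ = 2 * (√(Real.log n / n) / (p n : ℝ)) := by
            rw [e]
            field_simp
  refine ⟨fun n => 26 * s n, by simpa using hs.const_mul 26, ?_⟩
  filter_upwards [hppos, eventually_gt_atTop 36, hs.eventually_le_const
    (show (0 : ℝ) < 1 / 20 by norm_num)] with n hpn hn hsn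
  have hn36 : (36 : ℝ) < n := by exact_mod_cast hn
  have hbad := binomialRandom_real_not_isQuasirandom_le (by omega : 2 ≤ n) (p n)
  have hpow : (6 : ℝ) / n < (n : ℝ) ^ (-(1 / 2) : ℝ) := by
    have h6 : 6 < √(n : ℝ) := Real.lt_sqrt_of_sq_lt (by linarith)
    rw [Real.rpow_neg (by linarith), ← Real.sqrt_eq_rpow, ← one_div,
      div_lt_div_iff₀ (by linarith) (by linarith), one_mul]
    calc 6 * √(n : ℝ) < √(n : ℝ) * √(n : ℝ) := by gcongr
      _ = n := Real.mul_self_sqrt (by linarith)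
  have hgood : {G : SimpleGraph (Fin n) |
      IsQuasirandom (fun i j => (unitWeight G i j : ℝ)) (p n) √(n * Real.log n)} ⊆
      {G | optimalRatioCost (unitWeight G) ≠ ∞ ∧ |(optimalRatioCost (unitWeight G)).toReal -
        2 / (3 * (p n : ℝ) - (p n : ℝ) ^ 2)| ≤
          26 * s n * (2 / (3 * (p n : ℝ) - (p n : ℝ) ^ 2))} := by
    intro G hG
    refine IsQuasirandom.optimalRatioCost_approx hG hpn (p n).2.2 (Real.sqrt_nonneg _) (by omega)
      ?_ hsn
    have : 0 < (p n : ℝ) * n := mul_pos hpn (by linarith)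
    exact (div_mul_cancel₀ _ this.ne').symm
  have hmono := MeasureTheory.measureReal_mono (μ := SimpleGraph.binomialRandom (Fin n) (p n)) hgood
  have hcover : (1 : ℝ) ≤ (SimpleGraph.binomialRandom (Fin n) (p n)).real
      {G | IsQuasirandom (fun i j => (unitWeight G i j : ℝ)) (p n) √(n * Real.log n)} +
      (SimpleGraph.binomialRandom (Fin n) (p n)).real
      {G | ¬ IsQuasirandom (fun i j => (unitWeight G i j : ℝ)) (p n) √(n * Real.log n)} := by
    rw [← MeasureTheory.probReal_univ (μ := SimpleGraph.binomialRandom (Fin n) (p n))]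
    refine (MeasureTheory.measureReal_mono fun G _ => ?_).trans
      (MeasureTheory.measureReal_union_le _ _)
    exact Classical.em
      (IsQuasirandom (fun i j => (unitWeight G i j : ℝ)) (p n) √(n * Real.log n))
  linarith
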